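/- An isosceles right triangle is a nondegenerate triangle in the Euclidean plane that has a right angle whose two legs have equal length. For a finite set $P$ of points in the plane, let $S_\triangle(P)$ be the number of $3$-element subsets of $P$ that are the vertex sets of isosceles right triangles, and let $S_\triangle(n)=\max_{|P|=n}S_\triangle(P)$, the maximum being over all sets $P$ of $n$ points in the plane. Then $$S_\triangle(3)=1,\quad S_\triangle(4)=4,\quad S_\triangle(5)=8,\quad S_\triangle(6)=11,\quad S_\triangle(7)=15,\quad S_\triangle(8)=20,\quad S_\triangle(9)=28.$$ -/

import Mathlib

/-- The Euclidean plane. -/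
abbrev Plane : Type := EuclideanSpace ℝ (Fin 2)

/-- A set `T` of points is the vertex set of a (nondegenerate) isosceles right triangle:
`T = {a, b, c}`, where the legs `ab` and `ac` are nonzero, equally long and perpendicular. -/
def IsIRT (T : Finset Plane) : Prop :=
  ∃ a b c : Plane, (T : Set Plane) = {a, b, c} ∧ b ≠ a ∧
    dist a b = dist a c ∧ inner ℝ (b - a) (c - a) = 0

open Classical in
/-- The number of 3-element subsets of `P` that are the vertices of an isosceles right triangle. -/
noncomputable def numIRT (P : Finset Plane) : ℕ :=
  ((P.powersetCard 3).filter IsIRT).card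

/-- The maximum of `numIRT P` over all sets `P` of `n` points in the plane. -/
noncomputable def maxIRT (n : ℕ) : ℕ :=
  sSup {m : ℕ | ∃ P : Finset Plane, P.card = n ∧ numIRT P = m}

/-- The supremum in the definition of `maxIRT` is an attained maximum. -/
theorem maxIRT_isGreatest (n : ℕ) :
    IsGreatest {m : ℕ | ∃ P : Finset Plane, P.card = n ∧ numIRT P = m} (maxIRT n) := by
  have hb : BddAbove {m : ℕ | ∃ P : Finset Plane, P.card = n ∧ numIRT P = m} := by
    refine ⟨n.choose 3, ?_⟩
    rintro m ⟨P, hP, rfl⟩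
    rw [← hP, ← Finset.card_powersetCard]
    classical
    unfold numIRT
    exact Finset.card_le_card (Finset.filter_subset _ _)
  have hne : {m : ℕ | ∃ P : Finset Plane, P.card = n ∧ numIRT P = m}.Nonempty := by
    obtain ⟨P, hP⟩ := Infinite.exists_subset_card_eq Plane n
    exact ⟨numIRT P, P, hP, rfl⟩
  exact ⟨Nat.sSup_mem hne hb, fun m hm => le_csSup hb hm⟩

/-! The lower bounds come from explicit lattice sets; the upper bounds come from classifying, up to
direct similarity, the sets with many triangles. Summing degrees, a set of `n` points with `S`
triangles has a point in at most `3S/n` of them (`exists_erase_le`). Hence 29 triangles on nine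
points force 20 on some eight, these force 13 on seven, then 8 on six, 4 on five, 2 on four and 1 on
three. If the deleted point lies in some triangle, it is the third vertex over two remaining points,
so there are finitely many ways to put it back (`InClass.extend`). Starting from the single
triangle, all configurations stay in the Gaussian integers up to similarity, and the kernel checks
that each extension reaching the threshold is similar to a listed one. No extension to nine points
reaches 29. The gap is a deleted point in no triangle, whose position is unconstrained, such as a
point added to a square. This can happen only at the thresholds 4 and 8. There another point is
deleted instead: two points each isolated from the rest `Q` would have to form a triangle with every
point of `Q`, but the six possible third vertices carry only two triangles
(`numIRT_lt_of_isolated`). -/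

namespace IRT

/-! ### Computation with lattice configurations -/

/-- The squared distance of two lattice points. -/
def sqDist (z w : ℕ × ℕ) : ℕ :=
  (z.1 - w.1) * (z.1 - w.1) + (w.1 - z.1) * (w.1 - z.1) +
    ((z.2 - w.2) * (z.2 - w.2) + (w.2 - z.2) * (w.2 - z.2))

/-- The three squared distances are those of an isosceles right triangle with legs `ab`, `ac`. -/
def apexB (ab ac bc : ℕ) : Bool := Nat.beq ab ac && Nat.beq bc (ab + ac)

/-- Three lattice points form an isosceles right triangle. -/
def irtB (a b c : ℕ × ℕ) : Bool :=
  apexB (sqDist a b) (sqDist a c) (sqDist b c) ||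
  (apexB (sqDist a b) (sqDist b c) (sqDist a c) ||
  apexB (sqDist a c) (sqDist b c) (sqDist a b))

/-- The number of isosceles right triangles formed by `c` and two points of the list. -/
def degB (c : ℕ × ℕ) : List (ℕ × ℕ) → ℕ
  | [] => 0
  | z :: L => degB c L + L.countP (irtB c z)

/-- The number of isosceles right triangles with vertices in the list. -/
def countB : List (ℕ × ℕ) → ℕ
  | [] => 0
  | z :: L => countB L + degB z L

/-- The list scaled by `2` and translated by `(8, 8)`. -/
def dbl (L : List (ℕ × ℕ)) : List (ℕ × ℕ) := L.map fun z => (2 * z.1 + 8, 2 * z.2 + 8)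

/-- The list `(x, y) :: L`, arranged so that reduction computes `x` and `y` first. -/
def consEval (x y : ℕ) (L : List (ℕ × ℕ)) : List (ℕ × ℕ) :=
  match x with
  | 0 => match y with
    | 0 => (0, 0) :: L
    | n + 1 => (0, n + 1) :: L
  | m + 1 => match y with
    | 0 => (m + 1, 0) :: L
    | n + 1 => (m + 1, n + 1) :: L

/-- The third vertices, in the coordinates of `dbl`, of the isosceles right triangles on two
points with coordinates at most `4`, prepended to a list. -/
def thirds (p q : ℕ × ℕ) (L : List (ℕ × ℕ)) : List (ℕ × ℕ) :=
  consEval (2 * p.1 + 2 * p.2 + 8 - 2 * q.2) (2 * p.2 + 2 * q.1 + 8 - 2 * p.1) <|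
  consEval (2 * p.1 + 2 * q.2 + 8 - 2 * p.2) (2 * p.2 + 2 * p.1 + 8 - 2 * q.1) <|
  consEval (2 * q.1 + 2 * p.2 + 8 - 2 * q.2) (2 * q.2 + 2 * q.1 + 8 - 2 * p.1) <|
  consEval (2 * q.1 + 2 * q.2 + 8 - 2 * p.2) (2 * q.2 + 2 * p.1 + 8 - 2 * q.1) <|
  consEval (p.1 + q.1 + p.2 + 8 - q.2) (p.2 + q.2 + q.1 + 8 - p.1) <|
  consEval (p.1 + q.1 + q.2 + 8 - p.2) (p.2 + q.2 + p.1 + 8 - q.1) L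

/-- Membership in a list of lattice points. -/
def memB (c : ℕ × ℕ) : List (ℕ × ℕ) → Bool
  | [] => false
  | z :: L => (Nat.beq c.1 z.1 && Nat.beq c.2 z.2) || memB c L

/-- The third vertices, in the coordinates of `dbl`, of the isosceles right triangles on `z` and a
point of the first list, prepended to the second list. -/
def candsFrom (z : ℕ × ℕ) : List (ℕ × ℕ) → List (ℕ × ℕ) → List (ℕ × ℕ)
  | [], C => C
  | w :: L, C => thirds z w (candsFrom z L C)

/-- The third vertices, in the coordinates of `dbl`, of the isosceles right triangles on two listed
points. -/
def cands : List (ℕ × ℕ) → List (ℕ × ℕ)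
  | [] => []
  | z :: L => candsFrom z L (cands L)

/-- Removal of repetitions. -/
def nub : List (ℕ × ℕ) → List (ℕ × ℕ)
  | [] => []
  | z :: L => bif memB z L then nub L else z :: nub L

/-- The difference of two lattice points. -/
def sub (z w : ℕ × ℕ) : ℤ × ℤ := (Int.subNatNat z.1 w.1, Int.subNatNat z.2 w.2)

/-- The product of two lattice points, viewed as Gaussian integers. -/
def mul (z w : ℤ × ℤ) : ℤ × ℤ := (z.1 * w.1 - z.2 * w.2, z.1 * w.2 + z.2 * w.1)

/-- The largest squared distance between two points of the list. -/
def diamB (M : List (ℕ × ℕ)) : ℕ :=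
  M.foldr (fun p d => M.foldr (fun q e => bif Nat.ble e (sqDist p q) then sqDist p q else e) d) 0

/-- The sum of the squared distances between the points of the list. -/
def sumB (M : List (ℕ × ℕ)) : ℕ :=
  M.foldr (fun p d => M.foldr (fun q e => e + sqDist p q) d) 0

/-- Some direct similarity maps the list `L` into `M`, and the first two points of `L` to points of
`M` at squared distance `d`. The comparison of sums only serves to reject most pairs early. -/
def simB (d s : ℕ) (M : List (ℕ × ℕ)) : List (ℕ × ℕ) → Bool
  | z₀ :: z₁ :: L => Nat.ble 1 d && Nat.beq (s * sqDist z₀ z₁) (d * sumB (z₀ :: z₁ :: L)) &&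
      M.any fun p => M.any fun q => Nat.beq (sqDist p q) d &&
      L.all fun z => M.any fun w =>
        decide (mul (sub w p) (sub z₁ z₀) = mul (sub z z₀) (sub q p))
  | _ => false

/-- The value `f n`, arranged so that reduction computes `n` first. -/
def applyEval (n : ℕ) (f : ℕ → Bool) : Bool :=
  match n with
  | 0 => f 0
  | n + 1 => f (n + 1)

/-- Every extension of `L` by a third vertex to a configuration with `t` triangles is similar to a
configuration in `R`. -/
def stepB (t : ℕ) (L : List (ℕ × ℕ)) (R : List (List (ℕ × ℕ))) : Bool :=
  (nub (cands L)).all fun c => Nat.ble (degB c (dbl L) + countB L + 1) t ||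
    (memB c (dbl L) ||
    -- Similarities preserve the largest distance, so only pairs at that distance are tried as
    -- images of the first two points of a representative.
    applyEval (diamB (c :: dbl L)) fun d => applyEval (sumB (c :: dbl L)) fun s =>
      R.any (simB d s (c :: dbl L)))

/-! ### Representatives of the similarity classes -/

/-- The isosceles right triangle, up to direct similarity. -/
def reps3 : List (List (ℕ × ℕ)) := [[(0, 0), (1, 0), (0, 1)]]

/-- The configurations of `4` points with at least `2` isosceles right triangles that arise
from the previous list by adding third vertices, up to direct similarity. -/
def reps4 : List (List (ℕ × ℕ)) :=
  [[(1, 1), (0, 0), (0, 1), (1, 0)],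
   [(2, 1), (0, 1), (1, 0), (1, 1)],
   [(2, 0), (0, 1), (0, 0), (1, 1)],
   [(2, 1), (0, 0), (0, 1), (1, 0)],
   [(2, 0), (0, 1), (1, 0), (1, 1)],
   [(2, 1), (0, 0), (1, 0), (1, 1)]]

/-- The configurations of `5` points with at least `4` isosceles right triangles that arise
from the previous list by adding third vertices, up to direct similarity. -/
def reps5 : List (List (ℕ × ℕ)) :=
  [[(2, 1), (0, 1), (1, 0), (1, 1), (1, 2)],
   [(2, 0), (0, 1), (0, 0), (1, 0), (1, 1)],
   [(2, 1), (0, 0), (0, 1), (1, 0), (1, 1)],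
   [(2, 2), (0, 0), (0, 2), (1, 1), (1, 2)],
   [(2, 1), (0, 0), (0, 1), (1, 0), (1, 2)],
   [(2, 2), (0, 0), (0, 1), (0, 2), (1, 1)],
   [(2, 2), (0, 0), (0, 1), (1, 1), (2, 0)],
   [(3, 0), (0, 1), (1, 0), (1, 1), (2, 1)],
   [(3, 2), (0, 1), (1, 0), (1, 1), (1, 2)],
   [(3, 0), (0, 1), (1, 0), (1, 1), (1, 2)],
   [(2, 1), (0, 0), (0, 1), (1, 1), (1, 2)],
   [(2, 2), (0, 0), (0, 2), (1, 0), (1, 1)],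
   [(3, 1), (0, 0), (1, 0), (1, 1), (2, 0)],
   [(2, 2), (0, 1), (1, 0), (1, 1), (1, 2)]]

/-- The configurations of `6` points with at least `8` isosceles right triangles that arise
from the previous list by adding third vertices, up to direct similarity. -/
def reps6 : List (List (ℕ × ℕ)) :=
  [[(2, 1), (0, 0), (0, 1), (1, 0), (1, 1), (1, 2)],
   [(2, 2), (0, 0), (0, 1), (0, 2), (1, 1), (2, 0)],
   [(3, 0), (0, 1), (1, 0), (1, 1), (1, 2), (2, 1)],
   [(2, 1), (0, 0), (0, 1), (1, 0), (1, 1), (2, 0)],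
   [(3, 2), (0, 1), (1, 0), (1, 1), (1, 2), (2, 1)],
   [(2, 2), (0, 0), (0, 1), (0, 2), (1, 1), (1, 2)],
   [(3, 1), (0, 2), (1, 0), (1, 1), (2, 0), (2, 2)],
   [(2, 2), (0, 0), (0, 1), (1, 0), (1, 1), (2, 0)],
   [(3, 2), (0, 1), (1, 0), (1, 2), (2, 1), (2, 2)],
   [(3, 2), (0, 1), (1, 0), (1, 2), (2, 0), (2, 1)],
   [(3, 1), (0, 2), (1, 1), (1, 2), (2, 0), (2, 2)],
   [(3, 0), (0, 1), (1, 0), (1, 1), (2, 0), (2, 1)],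
   [(3, 1), (0, 1), (1, 0), (1, 1), (2, 0), (2, 1)],
   [(2, 1), (0, 0), (0, 1), (0, 2), (1, 1), (1, 2)],
   [(2, 2), (0, 0), (0, 1), (0, 2), (1, 0), (1, 1)],
   [(3, 1), (0, 0), (1, 0), (1, 1), (2, 0), (2, 1)],
   [(2, 1), (0, 0), (0, 1), (0, 2), (1, 0), (1, 1)]]

/-- The configurations of `7` points with at least `13` isosceles right triangles that arise
from the previous list by adding third vertices, up to direct similarity. -/
def reps7 : List (List (ℕ × ℕ)) :=
  [[(3, 1), (0, 0), (0, 2), (1, 1), (2, 0), (2, 1), (2, 2)],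
   [(2, 1), (0, 0), (0, 1), (0, 2), (1, 0), (1, 1), (1, 2)],
   [(3, 1), (0, 0), (0, 2), (1, 0), (1, 1), (2, 0), (2, 2)],
   [(3, 1), (0, 0), (0, 2), (1, 1), (1, 2), (2, 0), (2, 2)],
   [(2, 2), (0, 0), (0, 1), (0, 2), (1, 0), (1, 1), (2, 0)],
   [(3, 1), (0, 2), (1, 0), (1, 1), (2, 0), (2, 1), (2, 2)],
   [(3, 2), (0, 1), (1, 0), (1, 1), (1, 2), (2, 1), (2, 3)],
   [(3, 0), (0, 1), (1, 0), (1, 1), (1, 2), (2, 0), (2, 1)],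
   [(3, 2), (0, 1), (1, 0), (1, 1), (1, 2), (2, 1), (2, 2)],
   [(3, 2), (0, 1), (1, 0), (1, 1), (1, 2), (2, 0), (2, 1)],
   [(2, 2), (0, 0), (0, 1), (1, 0), (1, 1), (1, 2), (2, 1)],
   [(3, 1), (0, 0), (0, 1), (0, 2), (1, 1), (2, 0), (2, 2)],
   [(2, 2), (0, 0), (0, 1), (0, 2), (1, 1), (1, 2), (2, 1)],
   [(3, 1), (0, 0), (0, 2), (1, 1), (1, 2), (1, 3), (2, 2)],
   [(4, 2), (0, 2), (1, 1), (2, 0), (2, 1), (2, 2), (3, 1)],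
   [(3, 0), (0, 1), (0, 0), (1, 0), (1, 1), (1, 2), (2, 1)],
   [(3, 0), (0, 2), (0, 1), (1, 0), (1, 1), (1, 2), (2, 1)],
   [(2, 2), (0, 0), (0, 1), (0, 2), (1, 0), (1, 1), (1, 2)],
   [(3, 2), (0, 1), (0, 2), (1, 0), (1, 1), (1, 2), (2, 1)],
   [(3, 2), (0, 0), (0, 1), (1, 0), (1, 1), (1, 2), (2, 1)],
   [(3, 1), (0, 1), (1, 0), (1, 1), (1, 2), (2, 1), (2, 2)],
   [(3, 1), (0, 1), (1, 0), (1, 1), (1, 2), (2, 0), (2, 1)],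
   [(3, 2), (0, 1), (0, 3), (1, 0), (1, 1), (1, 2), (2, 1)]]

/-- The configurations of `8` points with at least `20` isosceles right triangles that arise
from the previous list by adding third vertices, up to direct similarity. -/
def reps8 : List (List (ℕ × ℕ)) :=
  [[(3, 2), (0, 1), (0, 3), (1, 0), (1, 1), (1, 2), (2, 1), (2, 3)],
   [(3, 1), (0, 0), (0, 2), (1, 0), (1, 1), (2, 0), (2, 1), (2, 2)],
   [(3, 2), (0, 1), (0, 3), (1, 0), (1, 2), (2, 1), (2, 2), (2, 3)],
   [(3, 1), (0, 0), (0, 2), (1, 1), (1, 2), (2, 0), (2, 1), (2, 2)],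
   [(2, 2), (0, 0), (0, 1), (0, 2), (1, 0), (1, 1), (1, 2), (2, 1)],
   [(3, 2), (0, 1), (1, 0), (1, 1), (1, 2), (2, 1), (2, 2), (2, 3)],
   [(3, 1), (0, 1), (1, 0), (1, 1), (1, 2), (2, 0), (2, 1), (2, 2)]]

/-! ### Kernel verification of the extension steps -/

set_option maxRecDepth 100000 in
theorem step3 : reps3.all (stepB 2 · reps4) = true := by decide +kernel

set_option maxRecDepth 100000 in
theorem step4 : reps4.all (stepB 4 · reps5) = true := by decide +kernel

set_option maxRecDepth 100000 in
theorem step5 : reps5.all (stepB 8 · reps6) = true := by decide +kernel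

set_option maxRecDepth 100000 in
theorem step6 : reps6.all (stepB 13 · reps7) = true := by decide +kernel

set_option maxRecDepth 100000 in
theorem step7 : reps7.all (stepB 20 · reps8) = true := by decide +kernel

-- With no representatives to match, the check passes only if every new point leaves fewer than 29
-- triangles.
set_option maxRecDepth 100000 in
theorem step8 : reps8.all (stepB 29 · []) = true := by decide +kernel

/-- The lists are configurations of `n` distinct points with coordinates at most `4`. -/
def Admissible (n : ℕ) (R : List (List (ℕ × ℕ))) : Prop :=
  ∀ L ∈ R, L.length = n ∧ L.Nodup ∧ ∀ z ∈ L, z.1 ≤ 4 ∧ z.2 ≤ 4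

theorem admissible3 : Admissible 3 reps3 := by unfold Admissible; decide +kernel

theorem admissible4 : Admissible 4 reps4 := by unfold Admissible; decide +kernel

theorem admissible5 : Admissible 5 reps5 := by unfold Admissible; decide +kernel

theorem admissible6 : Admissible 6 reps6 := by unfold Admissible; decide +kernel

theorem admissible7 : Admissible 7 reps7 := by unfold Admissible; decide +kernel

theorem admissible8 : Admissible 8 reps8 := by unfold Admissible; decide +kernel

theorem countB_reps5 : ∀ L ∈ reps5, countB L ≤ 8 := by decide +kernel

theorem countB_reps6 : ∀ L ∈ reps6, countB L ≤ 11 := by decide +kernel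

theorem countB_reps7 : ∀ L ∈ reps7, countB L ≤ 15 := by decide +kernel

theorem countB_reps8 : ∀ L ∈ reps8, countB L ≤ 20 := by decide +kernel

/-! ### Correctness of the list operations -/

theorem memB_iff {c : ℕ × ℕ} {L : List (ℕ × ℕ)} : memB c L = true ↔ c ∈ L := by
  induction L with
  | nil => simp [memB]
  | cons z L ih => simp [memB, ih, Prod.ext_iff]

theorem mem_nub {c : ℕ × ℕ} {L : List (ℕ × ℕ)} (h : c ∈ L) : c ∈ nub L := by
  induction L with
  | nil => simp at h
  | cons z L ih =>
    rw [nub]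
    cases hz : memB z L with
    | true =>
      rw [cond_true]
      rcases List.mem_cons.1 h with rfl | h
      · exact ih (memB_iff.1 hz)
      · exact ih h
    | false =>
      rw [cond_false]
      rcases List.mem_cons.1 h with rfl | h
      · exact List.mem_cons_self
      · exact List.mem_cons_of_mem _ (ih h)

theorem consEval_eq (x y : ℕ) (L : List (ℕ × ℕ)) : consEval x y L = (x, y) :: L := by
  cases x <;> cases y <;> rfl

theorem applyEval_eq (n : ℕ) (f : ℕ → Bool) : applyEval n f = f n := by
  cases n <;> rfl

theorem thirds_eq (p q : ℕ × ℕ) (L : List (ℕ × ℕ)) : thirds p q L = thirds p q [] ++ L := by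
  simp [thirds, consEval_eq]

theorem candsFrom_subset (z : ℕ × ℕ) (L C : List (ℕ × ℕ)) : C ⊆ candsFrom z L C := by
  induction L with
  | nil => simp [candsFrom]
  | cons w L ih =>
    rw [candsFrom, thirds_eq]
    exact fun x hx => List.mem_append_right _ (ih hx)

theorem mem_candsFrom {z w c : ℕ × ℕ} {L : List (ℕ × ℕ)} (C : List (ℕ × ℕ)) (hw : w ∈ L)
    (hc : c ∈ thirds z w []) : c ∈ candsFrom z L C := by
  induction L with
  | nil => simp at hw
  | cons u L ih =>
    rw [candsFrom, thirds_eq]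
    rcases List.mem_cons.1 hw with rfl | hw
    · exact List.mem_append_left _ hc
    · exact List.mem_append_right _ (ih hw)

/-- Needed because `cands` visits each pair only in the order of the list. -/
theorem pair_sublist {x y : ℕ × ℕ} {L : List (ℕ × ℕ)} (hx : x ∈ L) (hy : y ∈ L) (h : x ≠ y) :
    [x, y].Sublist L ∨ [y, x].Sublist L := by
  induction L with
  | nil => simp at hx
  | cons z L ih =>
    rcases List.mem_cons.1 hx with rfl | hx'
    · exact Or.inl (by simpa using (List.mem_cons.1 hy).resolve_left h.symm)
    rcases List.mem_cons.1 hy with rfl | hy'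
    · exact Or.inr (by simpa using hx')
    · exact (ih hx' hy').imp (·.cons _) (·.cons _)

theorem mem_cands {z w c : ℕ × ℕ} {L : List (ℕ × ℕ)} (h : [z, w].Sublist L)
    (hc : c ∈ thirds z w []) : c ∈ cands L := by
  induction L with
  | nil => simp at h
  | cons u L ih =>
    rw [cands]
    cases h with
    | cons _ h => exact candsFrom_subset _ _ _ (ih h)
    | cons_cons _ h => exact mem_candsFrom _ (by simpa using h) hc

/-! ### Isosceles right triangles through squared distances -/

/-- The squared distance of two points of the plane. -/
def sq (p q : Plane) : ℝ := (p 0 - q 0) ^ 2 + (p 1 - q 1) ^ 2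

theorem sq_comm (p q : Plane) : sq p q = sq q p := by unfold sq; ring

theorem sq_eq_zero {p q : Plane} : sq p q = 0 ↔ p = q := by
  constructor
  · intro h
    unfold sq at h
    ext i
    fin_cases i
    · simp; nlinarith [sq_nonneg (p 0 - q 0), sq_nonneg (p 1 - q 1)]
    · simp; nlinarith [sq_nonneg (p 0 - q 0), sq_nonneg (p 1 - q 1)]
  · rintro rfl
    simp [sq]

theorem sq_pos {p q : Plane} (h : p ≠ q) : 0 < sq p q :=
  lt_of_le_of_ne (by unfold sq; positivity) fun h' => h (sq_eq_zero.1 h'.symm)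

/-- The points `b` and `c` are the ends of legs of an isosceles right triangle that meet at `a`. -/
def Apex (a b c : Plane) : Prop := sq a b = sq a c ∧ sq b c = sq a b + sq a c

theorem Apex.swap {a b c : Plane} (h : Apex a b c) : Apex a c b :=
  ⟨h.1.symm, by rw [sq_comm c b, h.2, add_comm]⟩

/-- Perpendicularity of the legs is Pythagoras and its converse. -/
theorem legs_iff_apex (a b c : Plane) :
    (dist a b = dist a c ∧ inner ℝ (b - a) (c - a) = 0) ↔ Apex a b c := by
  have h1 : dist a b = dist a c ↔ sq a b = sq a c := by
    rw [EuclideanSpace.dist_eq, EuclideanSpace.dist_eq, Real.sqrt_inj (by positivity) (by positivity)]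
    simp [Fin.sum_univ_two, Real.dist_eq, sq]
  have h2 : inner ℝ (b - a) (c - a) = 0 ↔ sq b c = sq a b + sq a c := by
    simp only [PiLp.inner_apply, Fin.sum_univ_two, sq, PiLp.sub_apply, RCLike.inner_apply,
      conj_trivial]
    constructor <;> intro h <;> linarith
  rw [h1, h2, Apex]

theorem isIRT_triple {p q r : Plane} (hpq : p ≠ q) (hpr : p ≠ r) {T : Finset Plane}
    (hT : (T : Set Plane) = {p, q, r}) :
    IsIRT T ↔ Apex p q r ∨ Apex q p r ∨ Apex r p q := by
  constructor
  · rintro ⟨a, b, c, h, hab, hd, hi⟩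
    have hA := (legs_iff_apex a b c).1 ⟨hd, hi⟩
    rw [hT] at h
    have hp : p ∈ ({a, b, c} : Set Plane) := h ▸ by simp
    have hq : q ∈ ({a, b, c} : Set Plane) := h ▸ by simp
    have hr : r ∈ ({a, b, c} : Set Plane) := h ▸ by simp
    have ha : a ∈ ({p, q, r} : Set Plane) := h ▸ by simp
    have hb : b ∈ ({p, q, r} : Set Plane) := h ▸ by simp
    have hc : c ∈ ({p, q, r} : Set Plane) := h ▸ by simp
    have hac : a ≠ c := by
      rintro rfl
      have := hA.1
      rw [sq_eq_zero.2 (rfl : a = a)] at this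
      exact hab (sq_eq_zero.1 this).symm
    have hbc : b ≠ c := by
      rintro rfl
      have := hA.2
      rw [sq_eq_zero.2 (rfl : b = b)] at this
      have := sq_pos hab.symm
      linarith
    simp only [Set.mem_insert_iff, Set.mem_singleton_iff] at ha hb hc
    have hA' := hA.swap
    -- Since `a`, `b`, `c` are distinct, only the six permutations survive; each is one of the three
    -- apex cases up to swapping the legs.
    rcases ha with rfl | rfl | rfl <;> rcases hb with rfl | rfl | rfl <;>
      rcases hc with rfl | rfl | rfl <;> first | contradiction | tauto
  · rintro (h | h | h)
    · exact ⟨p, q, r, hT, hpq.symm, (legs_iff_apex _ _ _).2 h⟩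
    · exact ⟨q, p, r, by rw [hT]; ext; simp; tauto, hpq, (legs_iff_apex _ _ _).2 h⟩
    · exact ⟨r, p, q, by rw [hT]; ext; simp; tauto, hpr, (legs_iff_apex _ _ _).2 h⟩

/-! ### Lattice points in the plane -/

/-- The image of a lattice point under the direct similarity with value `a` at the origin and
linear part `v`, as complex numbers. -/
def emb (a v : Plane) (z : ℕ × ℕ) : Plane :=
  !₂[a 0 + z.1 * v 0 - z.2 * v 1, a 1 + z.1 * v 1 + z.2 * v 0]

@[simp] theorem emb_zero (a v : Plane) (z : ℕ × ℕ) :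
    emb a v z 0 = a 0 + z.1 * v 0 - z.2 * v 1 := rfl

@[simp] theorem emb_one (a v : Plane) (z : ℕ × ℕ) :
    emb a v z 1 = a 1 + z.1 * v 1 + z.2 * v 0 := rfl

theorem plane_ext {p q : Plane} (h0 : p 0 = q 0) (h1 : p 1 = q 1) : p = q := by
  ext i
  fin_cases i
  · exact h0
  · exact h1

theorem cast_sqDist (z w : ℕ × ℕ) :
    (sqDist z w : ℝ) = ((z.1 : ℝ) - w.1) ^ 2 + ((z.2 : ℝ) - w.2) ^ 2 := by
  -- With truncated subtraction at least one of the two products vanishes.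
  have key (m n : ℕ) : (((m - n) * (m - n) + (n - m) * (n - m) : ℕ) : ℝ) = ((m : ℝ) - n) ^ 2 := by
    rcases le_total m n with h | h
    · rw [Nat.sub_eq_zero_of_le h]; push_cast [Nat.cast_sub h]; ring
    · rw [Nat.sub_eq_zero_of_le h]; push_cast [Nat.cast_sub h]; ring
  rw [sqDist, Nat.cast_add, key, key]

theorem norm_pos {v : Plane} (hv : v ≠ 0) : 0 < v 0 ^ 2 + v 1 ^ 2 := by
  simpa [sq] using sq_pos hv

theorem sq_emb (a v : Plane) (z w : ℕ × ℕ) :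
    sq (emb a v z) (emb a v w) = (v 0 ^ 2 + v 1 ^ 2) * sqDist z w := by
  rw [cast_sqDist]
  simp only [sq, emb_zero, emb_one]
  ring

theorem emb_injective (a : Plane) {v : Plane} (hv : v ≠ 0) : Function.Injective (emb a v) := by
  intro z w h
  have h0 := sq_emb a v z w
  rw [sq_eq_zero.2 h, eq_comm, mul_eq_zero, cast_sqDist] at h0
  have h1 := h0.resolve_left (norm_pos hv).ne'
  have h2 : ((z.1 : ℝ) - w.1) = 0 := by
    nlinarith [sq_nonneg ((z.1 : ℝ) - w.1), sq_nonneg ((z.2 : ℝ) - w.2)]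
  have h3 : ((z.2 : ℝ) - w.2) = 0 := by
    nlinarith [sq_nonneg ((z.1 : ℝ) - w.1), sq_nonneg ((z.2 : ℝ) - w.2)]
  exact Prod.ext (by exact_mod_cast sub_eq_zero.1 h2) (by exact_mod_cast sub_eq_zero.1 h3)

theorem apex_emb (a : Plane) {v : Plane} (hv : v ≠ 0) (x y z : ℕ × ℕ) :
    Apex (emb a v x) (emb a v y) (emb a v z) ↔
      apexB (sqDist x y) (sqDist x z) (sqDist y z) = true := by
  have hn := (norm_pos hv).ne'
  rw [Apex, sq_emb, sq_emb, sq_emb, ← mul_add, mul_right_inj' hn, mul_right_inj' hn, apexB,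
    Bool.and_eq_true, Nat.beq_eq, Nat.beq_eq, ← Nat.cast_add, Nat.cast_inj, Nat.cast_inj]

theorem sqDist_comm (x y : ℕ × ℕ) : sqDist x y = sqDist y x := by
  unfold sqDist; ring

theorem isIRT_emb (a : Plane) {v : Plane} (hv : v ≠ 0) {x y z : ℕ × ℕ} (hxy : x ≠ y) (hxz : x ≠ z)
    {T : Finset Plane} (hT : (T : Set Plane) = {emb a v x, emb a v y, emb a v z}) :
    IsIRT T ↔ irtB x y z = true := by
  have hi := emb_injective a hv
  rw [isIRT_triple (hi.ne hxy) (hi.ne hxz) hT, apex_emb a hv, apex_emb a hv, apex_emb a hv, irtB,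
    Bool.or_eq_true, Bool.or_eq_true, sqDist_comm y x, sqDist_comm z x, sqDist_comm z y]

/-- Halving `v` undoes the doubling in `dbl`, and moving the origin to `a - (4 + 4i)v` undoes the
translation. -/
theorem emb_two (a : Plane) (v : Plane) (z : ℕ × ℕ) :
    emb (emb a (-v) (4, 4)) ((2⁻¹ : ℝ) • v) (2 * z.1 + 8, 2 * z.2 + 8) = emb a v z := by
  apply plane_ext <;> simp <;> ring

/-- The second leg of an isosceles right triangle is the first one, turned by a right angle. -/
theorem Apex.eq_rotation {a b p : Plane} (h : Apex a b p) (hab : a ≠ b) :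
    (p 0 = a 0 - (b 1 - a 1) ∧ p 1 = a 1 + (b 0 - a 0)) ∨
      (p 0 = a 0 + (b 1 - a 1) ∧ p 1 = a 1 - (b 0 - a 0)) := by
  have hpos := sq_pos hab
  obtain ⟨h1, h2⟩ := h
  unfold sq at h1 h2 hpos
  obtain ⟨x, hx⟩ : ∃ x, b 0 = a 0 + x := ⟨b 0 - a 0, by ring⟩
  obtain ⟨y, hy⟩ : ∃ y, b 1 = a 1 + y := ⟨b 1 - a 1, by ring⟩
  obtain ⟨s, hs⟩ : ∃ s, p 0 = a 0 + s := ⟨p 0 - a 0, by ring⟩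
  obtain ⟨t, ht⟩ : ∃ t, p 1 = a 1 + t := ⟨p 1 - a 1, by ring⟩
  rw [hx, hy] at h1 h2 hpos
  rw [hs, ht] at h1 h2
  rw [hx, hy, hs, ht]
  have hd : x * s + y * t = 0 := by linarith
  have hn : x ^ 2 + y ^ 2 = s ^ 2 + t ^ 2 := by linarith
  have hp : 0 < x ^ 2 + y ^ 2 := by linarith
  -- By Lagrange's identity the determinant of two orthogonal vectors of equal length is, up to
  -- sign, their squared length.
  have hc : (x * t - y * s - (x ^ 2 + y ^ 2)) * (x * t - y * s + (x ^ 2 + y ^ 2)) = 0 := by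
    linear_combination (-(x * s + y * t)) * hd - (x ^ 2 + y ^ 2) * hn
  rcases mul_eq_zero.1 hc with hc | hc
  · left
    constructor
    · refine mul_left_cancel₀ hp.ne' ?_
      linear_combination x * hd - y * hc
    · refine mul_left_cancel₀ hp.ne' ?_
      linear_combination y * hd + x * hc
  · right
    constructor
    · refine mul_left_cancel₀ hp.ne' ?_
      linear_combination x * hd - y * hc
    · refine mul_left_cancel₀ hp.ne' ?_
      linear_combination y * hd + x * hc

theorem Apex.ne {a b p : Plane} (h : Apex p a b) (hab : a ≠ b) : p ≠ a := by
  rintro rfl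
  have := h.1
  rw [sq_eq_zero.2 (rfl : p = p)] at this
  exact hab (sq_eq_zero.1 this.symm)

/-- The third vertices of the isosceles right triangles on two embedded lattice points. -/
theorem exists_mem_thirds (a v : Plane) {x y : ℕ × ℕ} (hx : x.1 ≤ 4 ∧ x.2 ≤ 4)
    (hy : y.1 ≤ 4 ∧ y.2 ≤ 4) {p : Plane} (hxy : emb a v x ≠ emb a v y)
    (h : Apex (emb a v x) (emb a v y) p ∨ Apex (emb a v y) (emb a v x) p ∨
      Apex p (emb a v x) (emb a v y)) :
    ∃ c ∈ thirds x y [], emb (emb a (-v) (4, 4)) ((2⁻¹ : ℝ) • v) c = p := by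
  obtain ⟨hx1, hx2⟩ := hx
  obtain ⟨hy1, hy2⟩ := hy
  -- Coordinates at most 4 make the offset 8 large enough that none of the twelve subtractions
  -- truncates.
  have c1 : ((2 * x.1 + 2 * x.2 + 8 - 2 * y.2 : ℕ) : ℝ) = 2 * x.1 + 2 * x.2 + 8 - 2 * y.2 := by
    push_cast [Nat.cast_sub (show 2 * y.2 ≤ 2 * x.1 + 2 * x.2 + 8 by omega)]; ring
  have c2 : ((2 * x.2 + 2 * y.1 + 8 - 2 * x.1 : ℕ) : ℝ) = 2 * x.2 + 2 * y.1 + 8 - 2 * x.1 := by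
    push_cast [Nat.cast_sub (show 2 * x.1 ≤ 2 * x.2 + 2 * y.1 + 8 by omega)]; ring
  have c3 : ((2 * x.1 + 2 * y.2 + 8 - 2 * x.2 : ℕ) : ℝ) = 2 * x.1 + 2 * y.2 + 8 - 2 * x.2 := by
    push_cast [Nat.cast_sub (show 2 * x.2 ≤ 2 * x.1 + 2 * y.2 + 8 by omega)]; ring
  have c4 : ((2 * x.2 + 2 * x.1 + 8 - 2 * y.1 : ℕ) : ℝ) = 2 * x.2 + 2 * x.1 + 8 - 2 * y.1 := by
    push_cast [Nat.cast_sub (show 2 * y.1 ≤ 2 * x.2 + 2 * x.1 + 8 by omega)]; ring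
  have c5 : ((2 * y.1 + 2 * x.2 + 8 - 2 * y.2 : ℕ) : ℝ) = 2 * y.1 + 2 * x.2 + 8 - 2 * y.2 := by
    push_cast [Nat.cast_sub (show 2 * y.2 ≤ 2 * y.1 + 2 * x.2 + 8 by omega)]; ring
  have c6 : ((2 * y.2 + 2 * y.1 + 8 - 2 * x.1 : ℕ) : ℝ) = 2 * y.2 + 2 * y.1 + 8 - 2 * x.1 := by
    push_cast [Nat.cast_sub (show 2 * x.1 ≤ 2 * y.2 + 2 * y.1 + 8 by omega)]; ring
  have c7 : ((2 * y.1 + 2 * y.2 + 8 - 2 * x.2 : ℕ) : ℝ) = 2 * y.1 + 2 * y.2 + 8 - 2 * x.2 := by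
    push_cast [Nat.cast_sub (show 2 * x.2 ≤ 2 * y.1 + 2 * y.2 + 8 by omega)]; ring
  have c8 : ((2 * y.2 + 2 * x.1 + 8 - 2 * y.1 : ℕ) : ℝ) = 2 * y.2 + 2 * x.1 + 8 - 2 * y.1 := by
    push_cast [Nat.cast_sub (show 2 * y.1 ≤ 2 * y.2 + 2 * x.1 + 8 by omega)]; ring
  have c9 : ((x.1 + y.1 + x.2 + 8 - y.2 : ℕ) : ℝ) = x.1 + y.1 + x.2 + 8 - y.2 := by
    push_cast [Nat.cast_sub (show y.2 ≤ x.1 + y.1 + x.2 + 8 by omega)]; ring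
  have c10 : ((x.2 + y.2 + y.1 + 8 - x.1 : ℕ) : ℝ) = x.2 + y.2 + y.1 + 8 - x.1 := by
    push_cast [Nat.cast_sub (show x.1 ≤ x.2 + y.2 + y.1 + 8 by omega)]; ring
  have c11 : ((x.1 + y.1 + y.2 + 8 - x.2 : ℕ) : ℝ) = x.1 + y.1 + y.2 + 8 - x.2 := by
    push_cast [Nat.cast_sub (show x.2 ≤ x.1 + y.1 + y.2 + 8 by omega)]; ring
  have c12 : ((x.2 + y.2 + x.1 + 8 - y.1 : ℕ) : ℝ) = x.2 + y.2 + x.1 + 8 - y.1 := by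
    push_cast [Nat.cast_sub (show y.1 ≤ x.2 + y.2 + x.1 + 8 by omega)]; ring
  simp only [thirds, consEval_eq, List.exists_mem_cons_iff]
  rcases h with h | h | h
  · rcases h.eq_rotation hxy with ⟨h0, h1⟩ | ⟨h0, h1⟩ <;> simp only [emb_zero, emb_one] at h0 h1
    · refine Or.inl (plane_ext ?_ ?_) <;> simp [c1, c2] <;> linarith
    · refine Or.inr (Or.inl (plane_ext ?_ ?_)) <;> simp [c3, c4] <;> linarith
  · rcases h.eq_rotation hxy.symm with ⟨h0, h1⟩ | ⟨h0, h1⟩ <;> simp only [emb_zero, emb_one] at h0 h1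
    · refine Or.inr (Or.inr (Or.inr (Or.inl (plane_ext ?_ ?_)))) <;> simp [c7, c8] <;> linarith
    · refine Or.inr (Or.inr (Or.inl (plane_ext ?_ ?_))) <;> simp [c5, c6] <;> linarith
  -- Here `p` is the apex: the rotation equations are linear and are solved for `p`, whose
  -- coordinates may be half-integers.
  · rcases h.eq_rotation (h.ne hxy) with ⟨h0, h1⟩ | ⟨h0, h1⟩ <;> simp only [emb_zero, emb_one] at h0 h1
    · refine Or.inr (Or.inr (Or.inr (Or.inr (Or.inl (plane_ext ?_ ?_))))) <;> simp [c9, c10] <;> linarith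
    · refine Or.inr (Or.inr (Or.inr (Or.inr (Or.inr (Or.inl (plane_ext ?_ ?_)))))) <;> simp [c11, c12] <;> linarith

/-! ### Counting triangles recursively -/

open Classical in
/-- The number of `k`-element subsets of `Q` with the property `F`. -/
noncomputable def numSub (k : ℕ) (F : Finset Plane → Prop) (Q : Finset Plane) : ℕ :=
  ((Q.powersetCard k).filter F).card

theorem numSub_zero (F : Finset Plane → Prop) (Q : Finset Plane) [Decidable (F ∅)] :
    numSub 0 F Q = if F ∅ then 1 else 0 := by
  classical
  rw [numSub, Finset.powersetCard_zero, Finset.filter_singleton]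
  split_ifs <;> rfl

theorem numSub_empty (k : ℕ) (F : Finset Plane → Prop) : numSub (k + 1) F ∅ = 0 := by
  simp [numSub]

-- The subsets are split by whether they contain `p`. This matches the recursions of `countB` and
-- `degB`, which fix the vertices one at a time.
open Classical in
theorem numSub_insert (k : ℕ) (F : Finset Plane → Prop) {p : Plane} {Q : Finset Plane}
    (hp : p ∉ Q) :
    numSub (k + 1) F (insert p Q) =
      numSub (k + 1) F Q + numSub k (fun s => F (insert p s)) Q := by
  rw [numSub, Finset.powersetCard_succ_insert hp, Finset.filter_union, Finset.card_union_of_disjoint,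
    numSub, numSub, Finset.filter_image, Finset.card_image_of_injOn]
  · intro s hs t ht hst
    have hs' : p ∉ s := fun h => hp ((Finset.mem_powersetCard.1 (Finset.mem_filter.1 hs).1).1 h)
    have ht' : p ∉ t := fun h => hp ((Finset.mem_powersetCard.1 (Finset.mem_filter.1 ht).1).1 h)
    have h := congrArg (fun u => Finset.erase u p) hst
    simpa [Finset.erase_insert hs', Finset.erase_insert ht'] using h
  · rw [Finset.disjoint_left]
    intro s hs hs'
    obtain ⟨t, -, rfl⟩ := Finset.mem_image.1 (Finset.mem_filter.1 hs').1
    exact hp ((Finset.mem_powersetCard.1 (Finset.mem_filter.1 hs).1).1 (Finset.mem_insert_self p t))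

theorem numIRT_eq_numSub (P : Finset Plane) : numIRT P = numSub 3 IsIRT P := rfl

/-- The list describes the point set in the coordinates of a direct similarity. -/
def Rep (P : Finset Plane) (L : List (ℕ × ℕ)) : Prop :=
  L.Nodup ∧ ∃ a v : Plane, v ≠ 0 ∧ ∀ p, p ∈ P ↔ ∃ z ∈ L, emb a v z = p

open Classical in
/-- The image of a list of lattice points under a direct similarity. -/
noncomputable def embSet (a v : Plane) (L : List (ℕ × ℕ)) : Finset Plane :=
  (L.map (emb a v)).toFinset

open Classical in
theorem embSet_cons (a v : Plane) (z : ℕ × ℕ) (L : List (ℕ × ℕ)) :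
    embSet a v (z :: L) = insert (emb a v z) (embSet a v L) := by
  simp [embSet]

theorem mem_embSet {a v p : Plane} {L : List (ℕ × ℕ)} :
    p ∈ embSet a v L ↔ ∃ z ∈ L, emb a v z = p := by
  classical
  simp [embSet]

theorem emb_notMem_embSet (a : Plane) {v : Plane} (hv : v ≠ 0) {z : ℕ × ℕ} {L : List (ℕ × ℕ)}
    (h : z ∉ L) : emb a v z ∉ embSet a v L := by
  rw [mem_embSet]
  rintro ⟨w, hw, he⟩
  exact h (emb_injective a hv he ▸ hw)

theorem numSub_one_embSet (a : Plane) {v : Plane} (hv : v ≠ 0) (F : Finset Plane → Prop)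
    (b : ℕ × ℕ → Bool) {L : List (ℕ × ℕ)} (hL : L.Nodup)
    (h : ∀ z ∈ L, F {emb a v z} ↔ b z = true) : numSub 1 F (embSet a v L) = L.countP b := by
  classical
  induction L with
  | nil => exact numSub_empty 0 F
  | cons z L ih =>
    rw [List.nodup_cons] at hL
    rw [embSet_cons, numSub_insert 0 F (emb_notMem_embSet a hv hL.1), numSub_zero,
      List.countP_cons, ih hL.2 fun w hw => h w (List.mem_cons_of_mem _ hw)]
    have := h z List.mem_cons_self
    simp only [insert_empty_eq, this]

open Classical in
theorem numSub_two_embSet (a : Plane) {v : Plane} (hv : v ≠ 0) {c : ℕ × ℕ} {L : List (ℕ × ℕ)}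
    (hL : (c :: L).Nodup) :
    numSub 2 (fun s => IsIRT (insert (emb a v c) s)) (embSet a v L) = degB c L := by
  induction L with
  | nil => exact numSub_empty 1 _
  | cons z L ih =>
    simp only [List.nodup_cons, List.mem_cons, not_or] at hL
    obtain ⟨⟨hcz, hcL⟩, hzL, hL⟩ := hL
    rw [embSet_cons, numSub_insert 1 _ (emb_notMem_embSet a hv hzL), degB,
      ih (List.nodup_cons.2 ⟨hcL, hL⟩), numSub_one_embSet a hv _ (irtB c z) hL]
    intro w hw
    exact isIRT_emb a hv hcz (fun h => hcL (h ▸ hw)) (by simp)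

theorem numIRT_embSet (a : Plane) {v : Plane} (hv : v ≠ 0) {L : List (ℕ × ℕ)} (hL : L.Nodup) :
    numIRT (embSet a v L) = countB L := by
  rw [numIRT_eq_numSub]
  induction L with
  | nil => exact numSub_empty 2 _
  | cons z L ih =>
    rw [embSet_cons, numSub_insert 2 _ (emb_notMem_embSet a hv (List.nodup_cons.1 hL).1), countB,
      ih (List.nodup_cons.1 hL).2, numSub_two_embSet a hv hL]

theorem card_embSet (a : Plane) {v : Plane} (hv : v ≠ 0) {L : List (ℕ × ℕ)} (hL : L.Nodup) :
    (embSet a v L).card = L.length := by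
  classical
  rw [embSet, List.toFinset_card_of_nodup (hL.map (emb_injective a hv)), List.length_map]

theorem rep_iff {P : Finset Plane} {L : List (ℕ × ℕ)} :
    Rep P L ↔ L.Nodup ∧ ∃ a v : Plane, v ≠ 0 ∧ P = embSet a v L := by
  simp only [Rep, Finset.ext_iff, mem_embSet]

theorem Rep.numIRT_eq {P : Finset Plane} {L : List (ℕ × ℕ)} (h : Rep P L) :
    numIRT P = countB L := by
  obtain ⟨hL, a, v, hv, rfl⟩ := rep_iff.1 h
  exact numIRT_embSet a hv hL

theorem cast_sub_fst (z w : ℕ × ℕ) : ((sub z w).1 : ℝ) = z.1 - w.1 := by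
  rw [sub, ← Int.subNatNat_eq_coe.symm]; push_cast [Int.subNatNat_eq_coe]; rfl

theorem cast_sub_snd (z w : ℕ × ℕ) : ((sub z w).2 : ℝ) = z.2 - w.2 := by
  rw [sub, ← Int.subNatNat_eq_coe.symm]; push_cast [Int.subNatNat_eq_coe]; rfl

/-! ### Transport along similarities -/

/-- A similarity found by `simB` transports a description of a point set. -/
theorem Rep.of_simB {P : Finset Plane} {d s : ℕ} {M L : List (ℕ × ℕ)} (h : Rep P M)
    (hs : simB d s M L = true) (hL : L.Nodup) (hlen : L.length = M.length) : Rep P L := by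
  match L, hs, hL, hlen with
  | z₀ :: z₁ :: L, hs, hL, hlen =>
  obtain ⟨hM, a, v, hv, rfl⟩ := rep_iff.1 h
  simp only [simB, Bool.and_eq_true, List.any_eq_true, List.all_eq_true, Nat.ble_eq, Nat.beq_eq,
    decide_eq_true_eq] at hs
  obtain ⟨⟨hd, -⟩, p, hp, q, hq, hpq, hall⟩ := hs
  have hz : z₀ ≠ z₁ := by
    rintro rfl
    simp at hL
  set N : ℝ := ((z₁.1 : ℝ) - z₀.1) ^ 2 + ((z₁.2 : ℝ) - z₀.2) ^ 2 with hN
  have hN0 : N ≠ 0 := by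
    intro h0
    have h1 : ((z₁.1 : ℝ) - z₀.1) = 0 := by
      nlinarith [sq_nonneg ((z₁.1 : ℝ) - z₀.1), sq_nonneg ((z₁.2 : ℝ) - z₀.2)]
    have h2 : ((z₁.2 : ℝ) - z₀.2) = 0 := by
      nlinarith [sq_nonneg ((z₁.1 : ℝ) - z₀.1), sq_nonneg ((z₁.2 : ℝ) - z₀.2)]
    exact hz (Prod.ext (by exact_mod_cast (sub_eq_zero.1 h1).symm)
      (by exact_mod_cast (sub_eq_zero.1 h2).symm))
  -- `A + iB` is the complex quotient `(q - p) / (z₁ - z₀)`, the linear part of the lattice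
  -- similarity.
  set A : ℝ := (((q.1 : ℝ) - p.1) * (z₁.1 - z₀.1) + (q.2 - p.2) * (z₁.2 - z₀.2)) / N with hA
  set B : ℝ := (((q.2 : ℝ) - p.2) * (z₁.1 - z₀.1) - (q.1 - p.1) * (z₁.2 - z₀.2)) / N with hB
  have key (z w : ℕ × ℕ) (h : mul (sub w p) (sub z₁ z₀) = mul (sub z z₀) (sub q p)) :
      ((z.1 : ℝ) - z₀.1) * A - (z.2 - z₀.2) * B = w.1 - p.1 ∧
      ((z.1 : ℝ) - z₀.1) * B + (z.2 - z₀.2) * A = w.2 - p.2 := by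
    have h1 := congrArg (fun x => ((x.1 : ℤ) : ℝ)) h
    have h2 := congrArg (fun x => ((x.2 : ℤ) : ℝ)) h
    simp only [mul] at h1 h2
    push_cast [cast_sub_fst, cast_sub_snd] at h1 h2
    have hA' : A * N = ((q.1 : ℝ) - p.1) * (z₁.1 - z₀.1) + (q.2 - p.2) * (z₁.2 - z₀.2) :=
      div_mul_cancel₀ _ hN0
    have hB' : B * N = ((q.2 : ℝ) - p.2) * (z₁.1 - z₀.1) - (q.1 - p.1) * (z₁.2 - z₀.2) :=
      div_mul_cancel₀ _ hN0
    constructor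
    · refine mul_right_cancel₀ hN0 ?_
      have : (((z.1 : ℝ) - z₀.1) * A - (z.2 - z₀.2) * B) * N =
        ((z.1 : ℝ) - z₀.1) * (A * N) - (z.2 - z₀.2) * (B * N) := by ring
      rw [this, hA', hB', hN]
      linear_combination (-((z₁.1 : ℝ) - z₀.1)) * h1 - ((z₁.2 : ℝ) - z₀.2) * h2
    · refine mul_right_cancel₀ hN0 ?_
      have : (((z.1 : ℝ) - z₀.1) * B + (z.2 - z₀.2) * A) * N =
        ((z.1 : ℝ) - z₀.1) * (B * N) + (z.2 - z₀.2) * (A * N) := by ring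
      rw [this, hA', hB', hN]
      linear_combination ((z₁.2 : ℝ) - z₀.2) * h1 - ((z₁.1 : ℝ) - z₀.1) * h2
  -- The new linear part is `v(A + iB)`; the translation `a'` is fixed by sending `z₀` to the image
  -- of `p`.
  set v' : Plane := !₂[v 0 * A - v 1 * B, v 0 * B + v 1 * A] with hv'
  set a' : Plane := !₂[emb a v p 0 - (z₀.1 * v' 0 - z₀.2 * v' 1),
    emb a v p 1 - (z₀.1 * v' 1 + z₀.2 * v' 0)] with ha'
  have hmap (z w : ℕ × ℕ) (h : mul (sub w p) (sub z₁ z₀) = mul (sub z z₀) (sub q p)) :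
      emb a' v' z = emb a v w := by
    obtain ⟨h1, h2⟩ := key z w h
    apply plane_ext
    · simp [ha', hv']
      linear_combination v 0 * h1 - v 1 * h2
    · simp [ha', hv']
      linear_combination v 1 * h1 + v 0 * h2
  have hmap₀ : emb a' v' z₀ = emb a v p := hmap _ _ (by simp [mul, sub, Int.subNatNat_eq_coe])
  have hmap₁ : emb a' v' z₁ = emb a v q := hmap _ _ (by simp only [mul, Prod.mk.injEq]; constructor <;> ring)
  have hv0 : v' ≠ 0 := by
    intro h0
    have h1 : emb a' v' z₀ = emb a' v' z₁ := by
      rw [h0]; apply plane_ext <;> simp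
    rw [hmap₀, hmap₁] at h1
    rw [emb_injective a hv h1] at hpq
    simp [sqDist] at hpq
    omega
  -- The lists have equal length, so inclusion of the images is enough.
  refine rep_iff.2 ⟨hL, a', v', hv0, (Finset.eq_of_subset_of_card_le ?_ ?_).symm⟩
  · intro x hx
    obtain ⟨z, hz, rfl⟩ := mem_embSet.1 hx
    rcases List.mem_cons.1 hz with rfl | hz
    · exact mem_embSet.2 ⟨p, hp, hmap₀.symm⟩
    rcases List.mem_cons.1 hz with rfl | hz
    · exact mem_embSet.2 ⟨q, hq, hmap₁.symm⟩
    obtain ⟨w, hw, h⟩ := hall z hz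
    exact mem_embSet.2 ⟨w, hw, (hmap z w h).symm⟩
  · rw [card_embSet a' hv0 hL, card_embSet a hv hM, hlen]

/-! ### Adding and deleting points -/

open Classical in
theorem numIRT_insert {p : Plane} {Q : Finset Plane} (hp : p ∉ Q) :
    numIRT (insert p Q) = numIRT Q + numSub 2 (fun s => IsIRT (insert p s)) Q :=
  numSub_insert 2 IsIRT hp

open Classical in
theorem numIRT_mono {Q P : Finset Plane} (h : Q ⊆ P) : numIRT Q ≤ numIRT P :=
  Finset.card_le_card (Finset.filter_subset_filter _ (Finset.powersetCard_mono h))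

open Classical in
theorem numIRT_le_choose (P : Finset Plane) : numIRT P ≤ P.card.choose 3 := by
  rw [← Finset.card_powersetCard]
  exact Finset.card_filter_le _ _

open Classical in
/-- Some point lies in at most an average number of isosceles right triangles. -/
theorem exists_erase_le {P : Finset Plane} (hP : P.Nonempty) :
    ∃ p ∈ P, P.card * numIRT P ≤ 3 * numIRT P + P.card * numIRT (P.erase p) := by
  have herase : ∀ p ∈ P, numIRT (P.erase p) =
      (((P.powersetCard 3).filter IsIRT).bipartiteAbove (fun p T => p ∉ T) p).card := by
    intro p _
    unfold numIRT
    congr 1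
    ext T
    simp only [Finset.mem_filter, Finset.mem_powersetCard, Finset.bipartiteAbove,
      Finset.subset_erase]
    tauto
  -- Double count pairs of a point and a triangle avoiding it: each triangle is avoided by all but
  -- three points.
  have hsum : ∑ p ∈ P, numIRT (P.erase p) + 3 * numIRT P = P.card * numIRT P := by
    rw [Finset.sum_congr rfl herase, Finset.sum_card_bipartiteAbove_eq_sum_card_bipartiteBelow,
      numIRT, mul_comm 3, mul_comm P.card, ← smul_eq_mul, ← smul_eq_mul, ← Finset.sum_const,
      ← Finset.sum_const, ← Finset.sum_add_distrib]
    refine Finset.sum_congr rfl fun T hT => ?_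
    obtain ⟨hTP, hT3⟩ := Finset.mem_powersetCard.1 (Finset.mem_filter.1 hT).1
    have : P.bipartiteBelow (fun p T => p ∉ T) T = P \ T := by
      ext; simp [Finset.bipartiteBelow]
    rw [this, Finset.card_sdiff_of_subset hTP, hT3]
    have := Finset.card_le_card hTP
    omega
  refine Finset.exists_le_of_sum_le hP ?_
  rw [Finset.sum_const, Finset.sum_add_distrib, Finset.sum_const, ← Finset.mul_sum, smul_eq_mul,
    smul_eq_mul, ← mul_add, add_comm (3 * _), hsum]

open Classical in
/-- Two points such that each point of `Q` completes them to an isosceles right triangle create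
further triangles unless `Q` carries few of them. -/
theorem numIRT_lt_of_isolated {x y : Plane} {Q : Finset Plane} (hxy : x ≠ y) (hx : x ∉ Q)
    (hy : y ∉ Q) (hQ : 3 ≤ numIRT Q) (hxQ : numIRT (insert x Q) ≤ numIRT Q)
    (hyQ : numIRT (insert y Q) ≤ numIRT Q) :
    numIRT (insert x (insert y Q)) < numIRT Q + Q.card := by
  by_contra! hlt
  have hxyQ : x ∉ insert y Q := by simp [hxy, hx]
  rw [numIRT_insert hxyQ, numSub_insert 1 _ hy] at hlt
  rw [numIRT_insert hx] at hxQ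
  -- Neither `x` nor `y` alone forms a triangle with `Q`, so every new triangle uses both and one
  -- point of `Q`.
  have hcard : Q.card ≤ numSub 1 (fun s => IsIRT (insert x (insert y s))) Q := by
    norm_num at hlt
    omega
  rw [numSub, Finset.powersetCard_one, Finset.filter_map, Finset.card_map] at hcard
  have hall := Finset.eq_of_subset_of_card_le (Finset.filter_subset _ _) hcard
  have hsub : Q ⊆ embSet (emb x (-(y - x)) (4, 4)) ((2⁻¹ : ℝ) • (y - x))
      (thirds (0, 0) (1, 0) []) := by
    intro q hq
    have hq' := hq
    rw [← hall, Finset.mem_filter] at hq'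
    have hqx : x ≠ q := fun h => hx (h ▸ hq)
    have h0 : emb x (y - x) (0, 0) = x := by apply plane_ext <;> simp
    have h1 : emb x (y - x) (1, 0) = y := by apply plane_ext <;> simp
    refine mem_embSet.2 (exists_mem_thirds x (y - x) (by simp) (by simp) ?_ ?_)
    · rwa [h0, h1]
    · rw [h0, h1]
      exact (isIRT_triple hxy hqx (by simp)).1 hq'.2
  have := numIRT_mono hsub
  rw [numIRT_embSet _ (by simpa [sub_eq_zero] using hxy.symm) (by decide)] at this
  -- The third vertices over `0` and `1` are `±i`, `1 ± i` and `(1 ± i)/2`; the only triangles among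
  -- them are the two with apex `(1 ± i)/2` and the adjacent unit side.
  have h2 : countB (thirds (0, 0) (1, 0) []) = 2 := by decide
  omega

/-! ### The extension step -/

/-- The point set is described by one of the lists. -/
def InClass (R : List (List (ℕ × ℕ))) (P : Finset Plane) : Prop := ∃ L ∈ R, Rep P L

theorem InClass.numIRT_le {R : List (List (ℕ × ℕ))} {P : Finset Plane} {m : ℕ} (h : InClass R P)
    (hR : ∀ L ∈ R, countB L ≤ m) : numIRT P ≤ m := by
  obtain ⟨L, hL, hP⟩ := h
  rw [hP.numIRT_eq]
  exact hR L hL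

theorem embSet_dbl (a v : Plane) (L : List (ℕ × ℕ)) :
    embSet (emb a (-v) (4, 4)) ((2⁻¹ : ℝ) • v) (dbl L) = embSet a v L := by
  ext p
  simp only [mem_embSet, dbl, List.mem_map, exists_exists_and_eq_and, emb_two]

open Classical in
/-- The extension step of the classification. -/
theorem InClass.extend {n t : ℕ} {R R' : List (List (ℕ × ℕ))} (hR : Admissible n R)
    (hR' : Admissible (n + 1) R') (hs : R.all (stepB t · R') = true) {P : Finset Plane} {p : Plane}
    (hp : p ∈ P) (hQ : InClass R (P.erase p)) (ht : t ≤ numIRT P)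
    (hlt : numIRT (P.erase p) < numIRT P) : InClass R' P := by
  obtain ⟨L, hLR, hrep⟩ := hQ
  have hcount := hrep.numIRT_eq
  obtain ⟨hL, a, v, hv, hQ⟩ := rep_iff.1 hrep
  obtain ⟨hlen, -, hsmall⟩ := hR L hLR
  have hpQ : p ∉ P.erase p := Finset.notMem_erase p P
  have hins : insert p (P.erase p) = P := Finset.insert_erase hp
  -- The strict increase in `hlt` puts `p` in some triangle, whose other two vertices are embedded
  -- lattice points.
  obtain ⟨x, hx, y, hy, hxy, hxyp⟩ : ∃ x ∈ L, ∃ y ∈ L, x ≠ y ∧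
      (Apex (emb a v x) (emb a v y) p ∨ Apex (emb a v y) (emb a v x) p ∨
        Apex p (emb a v x) (emb a v y)) := by
    have h := numIRT_insert hpQ
    rw [hins] at h
    obtain ⟨T, hT⟩ := Finset.card_pos.1
      (show 0 < numSub 2 (fun s => IsIRT (insert p s)) (P.erase p) by omega)
    rw [Finset.mem_filter, Finset.mem_powersetCard] at hT
    obtain ⟨⟨hTQ, hT2⟩, hT⟩ := hT
    obtain ⟨b, c, hbc, rfl⟩ := Finset.card_eq_two.1 hT2
    have hb : b ∈ P.erase p := hTQ (by simp)
    have hc : c ∈ P.erase p := hTQ (by simp)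
    have hpb : p ≠ b := (Finset.ne_of_mem_erase hb).symm
    have hpc : p ≠ c := (Finset.ne_of_mem_erase hc).symm
    rw [hQ] at hb hc
    obtain ⟨x, hx, rfl⟩ := mem_embSet.1 hb
    obtain ⟨y, hy, rfl⟩ := mem_embSet.1 hc
    refine ⟨x, hx, y, hy, fun h => hbc (h ▸ rfl), ?_⟩
    have := (isIRT_triple hpb hpc (by simp)).1 hT
    have h1 := @Apex.swap (emb a v x) p (emb a v y)
    have h2 := @Apex.swap (emb a v y) p (emb a v x)
    tauto
  obtain ⟨c, hc, hcp⟩ : ∃ c ∈ cands L,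
      emb (emb a (-v) (4, 4)) ((2⁻¹ : ℝ) • v) c = p := by
    have hne := (emb_injective a hv).ne hxy
    rcases pair_sublist hx hy hxy with h | h
    · obtain ⟨c, hc, h'⟩ := exists_mem_thirds a v (hsmall x hx) (hsmall y hy) hne hxyp
      exact ⟨c, mem_cands h hc, h'⟩
    · obtain ⟨c, hc, h'⟩ := exists_mem_thirds a v (hsmall y hy) (hsmall x hx) hne.symm
        (by have := @Apex.swap p (emb a v x) (emb a v y); tauto)
      exact ⟨c, mem_cands h hc, h'⟩
  have hdbl : (dbl L).Nodup := hL.map fun z w h => by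
    simp only [Prod.mk.injEq] at h
    exact Prod.ext (by omega) (by omega)
  have hcL : c ∉ dbl L := by
    intro h
    apply hpQ
    rw [hQ, ← embSet_dbl]
    exact mem_embSet.2 ⟨c, h, hcp⟩
  have hv2 : (2⁻¹ : ℝ) • v ≠ 0 := by simpa using hv
  have hPc : Rep P (c :: dbl L) := by
    refine rep_iff.2 ⟨List.nodup_cons.2 ⟨hcL, hdbl⟩, emb a (-v) (4, 4), _, hv2, ?_⟩
    rw [embSet_cons, embSet_dbl, hcp, ← hQ, hins]
  have hcd : countB (dbl L) = countB L := by
    rw [← hcount, hQ, ← embSet_dbl, numIRT_embSet _ hv2 hdbl]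
  have hcP := hPc.numIRT_eq
  rw [countB, hcd] at hcP
  have hstep := List.all_eq_true.1 (List.all_eq_true.1 hs L hLR) c (mem_nub hc)
  simp only [applyEval_eq, Bool.or_eq_true, Nat.ble_eq, memB_iff, List.any_eq_true] at hstep
  rcases hstep with h | h | ⟨L', hL', h⟩
  · omega
  · exact absurd h hcL
  · obtain ⟨hlen', hnd, -⟩ := hR' L' hL'
    exact ⟨L', hL', hPc.of_simB h hnd (by simp [hlen', dbl, hlen])⟩

/-! ### Classification from three to nine points -/

theorem inClass_three {P : Finset Plane} (hP : P.card = 3) (h : 1 ≤ numIRT P) :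
    InClass reps3 P := by
  classical
  obtain ⟨T, hT⟩ := Finset.card_pos.1 (show 0 < numIRT P from h)
  rw [Finset.mem_filter, Finset.mem_powersetCard] at hT
  obtain ⟨⟨hTP, hT3⟩, a, b, c, habc, hab, hlegs⟩ := hT
  rw [Finset.eq_of_subset_of_card_le hTP (by omega)] at habc
  have hmem : ∀ p, p ∈ P ↔ p = a ∨ p = b ∨ p = c := fun p => by
    rw [← Finset.mem_coe, habc]; simp
  have hA := (legs_iff_apex a b c).1 hlegs
  have key : ∀ b c : Plane, b ≠ a → (∀ p, p ∈ P ↔ p = a ∨ p = b ∨ p = c) →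
      c 0 = a 0 - (b 1 - a 1) → c 1 = a 1 + (b 0 - a 0) → InClass reps3 P := by
    intro b c hb hmem h0 h1
    refine ⟨_, List.mem_cons_self, by decide, a, b - a, sub_ne_zero.2 hb, fun p => ?_⟩
    have e0 : emb a (b - a) (0, 0) = a := by apply plane_ext <;> simp
    have e1 : emb a (b - a) (1, 0) = b := by apply plane_ext <;> simp
    have e2 : emb a (b - a) (0, 1) = c := by apply plane_ext <;> simp [h0, h1]
    simp [hmem, -Prod.exists, e0, e1, e2, eq_comm]
  -- Exchanging the legs reverses the orientation, so direct similarities suffice.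
  rcases hA.eq_rotation hab.symm with ⟨h0, h1⟩ | ⟨h0, h1⟩
  · exact key b c hab hmem h0 h1
  · have hca : c ≠ a := by
      rintro rfl
      have := hA.1
      rw [sq_eq_zero.2 (rfl : c = c)] at this
      exact hab (sq_eq_zero.1 this).symm
    refine key c b hca (fun p => by rw [hmem]; tauto) ?_ ?_ <;> linarith

/-- The point of smallest degree is removed, and the rest of the set is classified. -/
theorem exists_erase_of_card {P : Finset Plane} {n : ℕ} (hP : P.card = n + 1) :
    ∃ p ∈ P, (P.erase p).card = n ∧
      (n + 1) * numIRT P ≤ 3 * numIRT P + (n + 1) * numIRT (P.erase p) := by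
  obtain ⟨p, hp, h⟩ := exists_erase_le (P := P) (Finset.card_pos.1 (by omega))
  refine ⟨p, hp, ?_, hP ▸ h⟩
  rw [Finset.card_erase_of_mem hp, hP, Nat.add_sub_cancel]

theorem inClass_four {P : Finset Plane} (hP : P.card = 4) (h : 2 ≤ numIRT P) :
    InClass reps4 P := by
  obtain ⟨p, hp, hc, hle⟩ := exists_erase_of_card hP
  -- Three points carry at most one triangle, so the deleted point is not isolated.
  have hmax := numIRT_le_choose (P.erase p)
  rw [hc, Nat.choose_self] at hmax
  exact (inClass_three hc (by omega)).extend admissible3 admissible4 step3 hp h (by omega)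

/-- A set of five points with four triangles is classified, or it has a point in no triangle. -/
theorem inClass_five_or {P : Finset Plane} (hP : P.card = 5) (h : 4 ≤ numIRT P) :
    InClass reps5 P ∨ ∃ p ∈ P, numIRT (P.erase p) = numIRT P := by
  obtain ⟨p, hp, hc, hle⟩ := exists_erase_of_card hP
  have hmono := numIRT_mono (Finset.erase_subset p P)
  rcases hmono.lt_or_eq with hlt | heq
  · exact Or.inl
      ((inClass_four hc (by omega)).extend admissible4 admissible5 step4 hp h hlt)
  · exact Or.inr ⟨p, hp, heq⟩

theorem inClass_five {P : Finset Plane} (hP : P.card = 5) (h : 5 ≤ numIRT P) :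
    InClass reps5 P := by
  refine (inClass_five_or hP (by omega)).resolve_right ?_
  rintro ⟨p, hp, heq⟩
  have hmax := numIRT_le_choose (P.erase p)
  rw [Finset.card_erase_of_mem hp, hP, show Nat.choose (5 - 1) 3 = 4 from rfl] at hmax
  omega

theorem numIRT_le_five {P : Finset Plane} (hP : P.card = 5) : numIRT P ≤ 8 := by
  by_contra! h
  exact h.not_ge ((inClass_five hP (by omega)).numIRT_le countB_reps5)

/-- Two points, one of which creates no triangle with the remaining points `Q`, and `Q.card` or more
triangles outside of `Q`: then the other point does create a triangle with `Q`. -/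
theorem numIRT_lt_erase {P : Finset Plane} {x y : Plane} (hx : x ∈ P) (hy : y ∈ P.erase x)
    (hQ : 3 ≤ numIRT ((P.erase x).erase y))
    (hiso : numIRT ((P.erase x).erase y) = numIRT (P.erase x))
    (hP : numIRT (P.erase x) + (P.card - 2) ≤ numIRT P) :
    numIRT (P.erase x) < numIRT (P.erase y) := by
  classical
  by_contra! hle
  have hxy : x ≠ y := (Finset.ne_of_mem_erase hy).symm
  have hyx : insert y ((P.erase x).erase y) = P.erase x := Finset.insert_erase hy
  have hxP : insert x ((P.erase x).erase y) = P.erase y := by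
    rw [Finset.erase_right_comm, Finset.insert_erase (Finset.mem_erase.2 ⟨hxy, hx⟩)]
  have := numIRT_lt_of_isolated hxy (Q := (P.erase x).erase y) (by simp) (by simp) hQ
    (by rw [hxP]; omega) (by rw [hyx]; omega)
  rw [hyx, Finset.insert_erase hx, Finset.card_erase_of_mem hy, Finset.card_erase_of_mem hx] at this
  omega

/-- A set of six points with eight triangles is classified, or it has a point in no triangle. -/
theorem inClass_six_or {P : Finset Plane} (hP : P.card = 6) (h : 8 ≤ numIRT P) :
    InClass reps6 P ∨ ∃ p ∈ P, numIRT (P.erase p) = numIRT P := by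
  obtain ⟨p, hp, hc, hle⟩ := exists_erase_of_card hP
  have hmono := numIRT_mono (Finset.erase_subset p P)
  rcases hmono.lt_or_eq with hlt | heq
  · by_cases h5 : 5 ≤ numIRT (P.erase p)
    · exact Or.inl ((inClass_five hc h5).extend admissible5 admissible6 step5 hp h hlt)
    rcases inClass_five_or hc (by omega) with h' | ⟨y, hy, hiso⟩
    · exact Or.inl <| h'.extend admissible5 admissible6 step5 hp h hlt
    have hyP := Finset.mem_of_mem_erase hy
    -- Here `P.erase p` has exactly 4 triangles and `p` lies in at least `4 = 6 - 2`. Deleting `y`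
    -- instead leaves at least 5, which is classified unconditionally.
    have hlt' := numIRT_lt_erase hp hy (by omega) hiso (by omega)
    rcases (numIRT_mono (Finset.erase_subset y P)).lt_or_eq with hlt₂ | heq
    · exact Or.inl <| (inClass_five (by rw [Finset.card_erase_of_mem hyP, hP]) (by omega)).extend
        admissible5 admissible6 step5 hyP h hlt₂
    · exact Or.inr ⟨y, hyP, heq⟩
  · exact Or.inr ⟨p, hp, heq⟩

theorem inClass_six {P : Finset Plane} (hP : P.card = 6) (h : 9 ≤ numIRT P) :
    InClass reps6 P := by
  refine (inClass_six_or hP (by omega)).resolve_right ?_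
  rintro ⟨p, hp, heq⟩
  have hmax := numIRT_le_five (P := P.erase p) (by rw [Finset.card_erase_of_mem hp, hP])
  omega

theorem numIRT_le_six {P : Finset Plane} (hP : P.card = 6) : numIRT P ≤ 11 := by
  by_contra! h
  exact h.not_ge ((inClass_six hP (by omega)).numIRT_le countB_reps6)

theorem inClass_seven {P : Finset Plane} (hP : P.card = 7) (h : 13 ≤ numIRT P) :
    InClass reps7 P := by
  obtain ⟨p, hp, hc, hle⟩ := exists_erase_of_card hP
  have hmax := numIRT_le_six hc
  by_cases h9 : 9 ≤ numIRT (P.erase p)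
  · exact (inClass_six hc h9).extend admissible6 admissible7 step6 hp h (by omega)
  rcases inClass_six_or hc (by omega) with h' | ⟨y, hy, hiso⟩
  · exact h'.extend admissible6 admissible7 step6 hp h (by omega)
  have hyP := Finset.mem_of_mem_erase hy
  have hcy : (P.erase y).card = 6 := by rw [Finset.card_erase_of_mem hyP, hP]
  -- Now `P.erase p` has exactly 8 triangles and `13 - 8 = 7 - 2`. Deleting `y` leaves at least 9,
  -- and at most 11, so `y` is not isolated in `P`.
  have hlt := numIRT_lt_erase hp hy (by omega) hiso (by omega)
  have hmax := numIRT_le_six hcy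
  exact (inClass_six hcy (by omega)).extend admissible6 admissible7 step6 hyP h (by omega)

theorem numIRT_le_seven {P : Finset Plane} (hP : P.card = 7) : numIRT P ≤ 15 := by
  by_contra! h
  exact h.not_ge ((inClass_seven hP (by omega)).numIRT_le countB_reps7)

theorem inClass_eight {P : Finset Plane} (hP : P.card = 8) (h : 20 ≤ numIRT P) :
    InClass reps8 P := by
  obtain ⟨p, hp, hc, hle⟩ := exists_erase_of_card hP
  have hmax := numIRT_le_seven hc
  exact (inClass_seven hc (by omega)).extend admissible7 admissible8 step7 hp h (by omega)

theorem numIRT_le_eight {P : Finset Plane} (hP : P.card = 8) : numIRT P ≤ 20 := by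
  by_contra! h
  exact h.not_ge ((inClass_eight hP (by omega)).numIRT_le countB_reps8)

theorem numIRT_le_nine {P : Finset Plane} (hP : P.card = 9) : numIRT P ≤ 28 := by
  by_contra! h
  obtain ⟨p, hp, hc, hle⟩ := exists_erase_of_card hP
  have hmax := numIRT_le_eight hc
  obtain ⟨L, hL, -⟩ := (inClass_eight hc (by omega)).extend (R' := []) (n := 8) (t := 29)
    admissible8 (by simp [Admissible]) step8 hp h (by omega)
  simp at hL

/-- A list of lattice points realizes the upper bound. -/
theorem maxIRT_eq {n m : ℕ} {L : List (ℕ × ℕ)} (hlen : L.length = n) (hL : L.Nodup)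
    (hm : countB L = m) (hle : ∀ P : Finset Plane, P.card = n → numIRT P ≤ m) : maxIRT n = m := by
  have hv : (!₂[1, 0] : Plane) ≠ 0 := fun h => by simpa using congrArg (fun p : Plane => p 0) h
  refine (maxIRT_isGreatest n).unique ⟨⟨embSet 0 !₂[1, 0] L, ?_, ?_⟩, ?_⟩
  · rw [card_embSet 0 hv hL, hlen]
  · rw [numIRT_embSet 0 hv hL, hm]
  · rintro k ⟨P, hP, rfl⟩
    exact hle P hP

end IRT

open IRT
theorem theorem5 :
    maxIRT 3 = 1 ∧ maxIRT 4 = 4 ∧ maxIRT 5 = 8 ∧ maxIRT 6 = 11 ∧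
      maxIRT 7 = 15 ∧ maxIRT 8 = 20 ∧ maxIRT 9 = 28 := by
  refine ⟨
    maxIRT_eq (L := [(0, 0), (1, 0), (0, 1)]) rfl (by decide) (by decide)
      fun P hP => (numIRT_le_choose P).trans (by rw [hP]; rfl),
    maxIRT_eq (L := [(0, 0), (1, 0), (0, 1), (1, 1)]) rfl (by decide) (by decide)
      fun P hP => (numIRT_le_choose P).trans (by rw [hP]; rfl),
    -- From five points on, the witnesses are the `3 × 3` grid with four, three, two, one and no
    -- corners removed.
    maxIRT_eq (L := [(0, 1), (1, 0), (1, 1), (1, 2), (2, 1)]) rfl (by decide) (by decide +kernel)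
      fun P hP => numIRT_le_five hP,
    maxIRT_eq (L := [(1, 1), (1, 0), (0, 1), (1, 2), (2, 1), (2, 2)]) rfl (by decide)
      (by decide +kernel) fun P hP => numIRT_le_six hP,
    maxIRT_eq (L := [(0, 0), (1, 0), (2, 0), (0, 1), (1, 1), (2, 1), (1, 2)]) rfl (by decide)
      (by decide +kernel) fun P hP => numIRT_le_seven hP,
    maxIRT_eq (L := [(0, 0), (1, 0), (2, 0), (0, 1), (1, 1), (2, 1), (0, 2), (1, 2)]) rfl
      (by decide) (by decide +kernel) fun P hP => numIRT_le_eight hP,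
    maxIRT_eq (L := [(0, 0), (1, 0), (2, 0), (0, 1), (1, 1), (2, 1), (0, 2), (1, 2), (2, 2)]) rfl
      (by decide) (by decide +kernel) fun P hP => numIRT_le_nine hP⟩
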